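/- Let $n\ge 1$ and let $K$ be a centered convex body of volume $1$ in $\mathbb R^n$, that is, a compact convex set with non-empty interior, $|K|=1$ and $\int_K x\,dx=0$. Let $\mu_K$ be the uniform measure on $K$. Define, with values in the extended reals, $$\Lambda_{\mu_K}(\xi)=\ln\int_{\mathbb R^n}e^{\langle \xi,z\rangle}\,d\mu_K(z),\qquad \Lambda^*_{\mu_K}(x)=\sup_{\xi\in\mathbb R^n}\{\langle x,\xi\rangle-\Lambda_{\mu_K}(\xi)\},\qquad B_t(\mu_K)=\{x\in\mathbb R^n:\Lambda^*_{\mu_K}(x)\le t\},$$ and let $\varphi_{\mu_K}(x)=\inf\{\mu_K(H): H \text{ a closed half-space of } \mathbb R^n \text{ containing } x\}$ be Tukey's half-space depth and $\omega_{\mu_K}(x)=\ln(1/\varphi_{\mu_K}(x))$, where $\ln(1/0)=+\infty$. Then: 1. For every $t>0$, $$\inf\{\varphi_{\mu_K}(x):x\in B_t(\mu_K)\}\ \ge\ \tfrac1{10}\exp(-t-2\sqrt n).$$ 2. For every $x\in\mathbb R^n$, $$\omega_{\mu_K}(x)-5\sqrt n\ \le\ \Lambda^*_{\mu_K}(x)\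 \le\ \omega_{\mu_K}(x)$$ in the extended reals, and $\omega_{\mu_K}(x)<+\infty$ for $x$ in the interior of $K$ (so that there this is an inequality between real numbers). -/

import Mathlib

open MeasureTheory
open scoped ENNReal

noncomputable section

namespace TukeyCramer

/-- A convex body in `ℝⁿ`: a compact convex set with non-empty interior. -/
structure IsConvexBody {n : ℕ} (K : Set (EuclideanSpace ℝ (Fin n))) : Prop where
  convex : Convex ℝ K
  isCompact : IsCompact K
  nonempty_interior : (interior K).Nonempty

/-- The barycenter `(1/|K|) ∫_K x dx` of `K`. -/
def barycenter {n : ℕ} (K : Set (EuclideanSpace ℝ (Fin n))) : EuclideanSpace ℝ (Fin n) :=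
  (volume.real K)⁻¹ • ∫ x in K, x

/-- `K` is centered if its barycenter is at the origin. -/
def IsCentered {n : ℕ} (K : Set (EuclideanSpace ℝ (Fin n))) : Prop :=
  barycenter K = 0

/-- The uniform measure `μ_K` on `K`: `A ↦ |A ∩ K| / |K|`. -/
def uniformMeasure {n : ℕ} (K : Set (EuclideanSpace ℝ (Fin n))) :
    Measure (EuclideanSpace ℝ (Fin n)) :=
  ProbabilityTheory.cond volume K

/-- The logarithmic Laplace transform `Λ_μ(ξ) = ln ∫ e^{⟨ξ, z⟩} dμ(z)`, with values in the extended
reals (it is `+∞` where the integral diverges). -/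
def logLaplace {n : ℕ} (μ : Measure (EuclideanSpace ℝ (Fin n)))
    (ξ : EuclideanSpace ℝ (Fin n)) : EReal :=
  ENNReal.log (∫⁻ z, ENNReal.ofReal (Real.exp (inner ℝ ξ z)) ∂μ)

/-- The Cramér transform `Λ*_μ(x) = sup_ξ (⟨x, ξ⟩ - Λ_μ(ξ))`, with values in the extended reals. -/
def cramer {n : ℕ} (μ : Measure (EuclideanSpace ℝ (Fin n)))
    (x : EuclideanSpace ℝ (Fin n)) : EReal :=
  ⨆ ξ : EuclideanSpace ℝ (Fin n), ((inner ℝ x ξ : ℝ) : EReal) - logLaplace μ ξ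

/-- The sublevel set `B_t(μ) = {x : Λ*_μ(x) ≤ t}`. -/
def cramerSublevel {n : ℕ} (μ : Measure (EuclideanSpace ℝ (Fin n))) (t : ℝ) :
    Set (EuclideanSpace ℝ (Fin n)) :=
  {x | cramer μ x ≤ (t : EReal)}

/-- A (closed) half-space `{z : a ≤ ⟨θ, z⟩}`, `θ ≠ 0`. -/
def IsHalfSpace {n : ℕ} (H : Set (EuclideanSpace ℝ (Fin n))) : Prop :=
  ∃ (θ : EuclideanSpace ℝ (Fin n)) (a : ℝ), θ ≠ 0 ∧ H = {z | a ≤ inner ℝ θ z}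

/-- The set of all half-spaces containing `x`. -/
def halfSpacesAt {n : ℕ} (x : EuclideanSpace ℝ (Fin n)) :
    Set (Set (EuclideanSpace ℝ (Fin n))) :=
  {H | IsHalfSpace H ∧ x ∈ H}

/-- Tukey's half-space depth `φ_μ(x)`, the infimum of `μ(H)` over the half-spaces `H ∋ x`. -/
def depth {n : ℕ} (μ : Measure (EuclideanSpace ℝ (Fin n)))
    (x : EuclideanSpace ℝ (Fin n)) : ℝ≥0∞ :=
  ⨅ H ∈ halfSpacesAt x, μ H

/-- `ω_μ(x) = ln (1 / φ_μ(x))`, equal to `+∞` where `φ_μ(x) = 0`. -/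
def omega {n : ℕ} (μ : Measure (EuclideanSpace ℝ (Fin n)))
    (x : EuclideanSpace ℝ (Fin n)) : EReal :=
  ENNReal.log (1 / depth μ x)

end TukeyCramer

end

/-! Write F(ξ) = ∫_K e^{⟨ξ,z⟩} dz. The bound Λ* ≤ ω is Markov's inequality: the half-space {⟨ξ,z⟩ ≥
⟨ξ,x⟩} has measure at most e^{-⟨ξ,x⟩} F(ξ) (`depth_le_exp`).

For the reverse bound, Λ* = +∞ off the interior of K (`cramer_uniformMeasure_eq_top`), so let x be
interior and translate it to 0. Then F is coercive and has a minimizer ξ. Stationarity says that the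
probability measure on K with density e^{⟨ξ,z⟩}/F(ξ) has barycenter 0. It is log-concave, so
Grünbaum's inequality gives every half-space through 0 tilted mass at least 1/e
(`exp_neg_one_le_tiltedUniform`).

The density is moderate on most of that mass. By Prékopa–Leindler, s ↦ s^n F(sξ) is log-concave, and
F(sξ) is stationary at s = 1; hence F((1+r)ξ) ≤ F(ξ) e^{n r²/2} (`expIntegral_smul_le`), and
Chernoff's bound gives ⟨ξ,z⟩ ≥ 2√n tilted mass at most e^{-2}. Since 1/e - 1/e² ≥ 1/10, the
half-space meets K in volume at least (1/10) e^{-2√n} F(ξ). Finally F(ξ) = e^{-r}, where r is one of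
the values in the supremum defining Λ*(x). -/

/-! ### Brunn–Minkowski on the line and the Prékopa–Leindler inequality -/

/-- One-dimensional Brunn–Minkowski inequality for compact sets. -/
lemma volume_add_le_of_isCompact {A B C : Set ℝ} (hA : IsCompact A) (hB : IsCompact B)
    (hA0 : A.Nonempty) (hB0 : B.Nonempty) (h : ∀ x ∈ A, ∀ y ∈ B, x + y ∈ C) :
    volume A + volume B ≤ volume C := by
  set p := sSup A
  set q := sInf B
  have hp : p ∈ A := hA.sSup_mem hA0
  have hq : q ∈ B := hB.sInf_mem hB0
  -- The translates q + A and p + B both lie in C and meet at most in the point p + q.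
  have hA' : volume ((fun x => -q + x) ⁻¹' A) = volume A := measure_preimage_add _ _ _
  have hB' : volume ((fun x => -p + x) ⁻¹' B) = volume B := measure_preimage_add _ _ _
  have hBm : MeasurableSet ((fun x => -p + x) ⁻¹' B) :=
    hB.measurableSet.preimage (by fun_prop)
  rw [← hA', ← hB', ← measure_union_add_inter _ hBm]
  have h0 : volume ((fun x => -q + x) ⁻¹' A ∩ (fun x => -p + x) ⁻¹' B) = 0 := by
    refine measure_mono_null (t := {p + q}) ?_ (by simp)
    rintro x ⟨hx, hy⟩
    have h1 := le_csSup hA.bddAbove hx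
    have h2 := csInf_le hB.bddBelow hy
    simp only [Set.mem_singleton_iff]
    change -q + x ≤ p at h1
    change q ≤ -p + x at h2
    linarith
  rw [h0, add_zero]
  refine measure_mono ?_
  rintro x (hx | hx)
  · simpa using h _ hx _ hq
  · simpa using h _ hp _ hx

/-- One-dimensional Brunn–Minkowski inequality for measurable sets. -/
lemma volume_add_le_of_measurableSet {A B C : Set ℝ} (hA : MeasurableSet A)
    (hB : MeasurableSet B) (hA0 : A.Nonempty) (hB0 : B.Nonempty)
    (h : ∀ x ∈ A, ∀ y ∈ B, x + y ∈ C) :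
    volume A + volume B ≤ volume C := by
  obtain ⟨x₀, hx₀⟩ := hA0
  obtain ⟨y₀, hy₀⟩ := hB0
  have key : ∀ S, (S ⊆ A ∧ IsCompact S) → ∀ T, (T ⊆ B ∧ IsCompact T) →
      volume S + volume T ≤ volume C := by
    rintro S ⟨hSA, hS⟩ T ⟨hTB, hT⟩
    -- Compact approximants may be empty, so a point of each set is inserted.
    refine (add_le_add (measure_mono (Set.subset_insert x₀ S))
      (measure_mono (Set.subset_insert y₀ T))).trans
      (volume_add_le_of_isCompact (hS.insert x₀) (hT.insert y₀) (Set.insert_nonempty _ _)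
        (Set.insert_nonempty _ _) fun x hx y hy => h x ?_ y ?_)
    · exact Set.insert_subset hx₀ hSA hx
    · exact Set.insert_subset hy₀ hTB hy
  have := ENNReal.biSup_add_biSup_le' (f := fun S : Set ℝ => volume S)
    (g := fun S : Set ℝ => volume S) ⟨∅, by simp⟩ ⟨∅, by simp⟩ key
  rw [hA.measure_eq_iSup_isCompact, hB.measure_eq_iSup_isCompact]
  simpa only [iSup_and] using this

lemma volume_convex_comb_le {A B C : Set ℝ} (hA : MeasurableSet A)
    (hB : MeasurableSet B) (hA0 : A.Nonempty) (hB0 : B.Nonempty) {a b : ℝ} (ha : 0 < a)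
    (hb : 0 < b) (h : ∀ x ∈ A, ∀ y ∈ B, a * x + b * y ∈ C) :
    ENNReal.ofReal a * volume A + ENNReal.ofReal b * volume B ≤ volume C := by
  have := volume_add_le_of_measurableSet (hA.const_smul₀ a) (hB.const_smul₀ b)
    (hA0.smul_set) (hB0.smul_set) (C := C) (by
      rintro _ ⟨x, hx, rfl⟩ _ ⟨y, hy, rfl⟩
      exact h x hx y hy)
  simpa [Measure.addHaar_smul, abs_of_pos ha, abs_of_pos hb] using this

lemma lintegral_eq_lintegral_meas_lt_of_le_one {α : Type*} [MeasurableSpace α] (μ : Measure α)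
    {f : α → ℝ≥0∞} (hf : Measurable f) (hf1 : ∀ x, f x ≤ 1) :
    ∫⁻ x, f x ∂μ = ∫⁻ t in Set.Ioi (0 : ℝ), μ {x | ENNReal.ofReal t < f x} := by
  have hfin : ∀ x, f x ≠ ⊤ := fun x => ne_top_of_le_ne_top ENNReal.one_ne_top (hf1 x)
  have := lintegral_eq_lintegral_meas_lt μ (f := fun x => (f x).toReal)
    (Filter.Eventually.of_forall fun x => ENNReal.toReal_nonneg) hf.ennreal_toReal.aemeasurable
  simp only [ENNReal.ofReal_toReal (hfin _)] at this
  rw [this]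
  refine setLIntegral_congr_fun measurableSet_Ioi fun t ht => ?_
  simp only [ENNReal.ofReal_lt_iff_lt_toReal (le_of_lt ht) (hfin _)]

lemma ENNReal.geom_mean_le_arith_mean2 {a b : ℝ} (ha : 0 < a) (hb : 0 < b) (hab : a + b = 1)
    (x y : ℝ≥0∞) : x ^ a * y ^ b ≤ ENNReal.ofReal a * x + ENNReal.ofReal b * y := by
  by_cases hx : x = ⊤
  · simp [hx, ENNReal.mul_top, ha]
  by_cases hy : y = ⊤
  · simp [hy, ENNReal.mul_top, hb]
  lift x to NNReal using hx
  lift y to NNReal using hy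
  have := NNReal.geom_mean_le_arith_mean2_weighted a.toNNReal b.toNNReal x y
    (by rw [← Real.toNNReal_add ha.le hb.le, hab, Real.toNNReal_one])
  rw [Real.coe_toNNReal _ ha.le, Real.coe_toNNReal _ hb.le] at this
  rw [← ENNReal.coe_rpow_of_nonneg _ ha.le, ← ENNReal.coe_rpow_of_nonneg _ hb.le]
  simp only [ENNReal.ofReal]
  exact_mod_cast this

/-- One-dimensional Prékopa–Leindler inequality for functions with supremum `1`. -/
lemma prekopa_leindler_real_of_iSup_eq_one {a b : ℝ} (ha : 0 < a) (hb : 0 < b) (hab : a + b = 1)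
    {f g h : ℝ → ℝ≥0∞} (hf : Measurable f) (hg : Measurable g) (hh : Measurable h)
    (hf1 : ⨆ x, f x = 1) (hg1 : ⨆ x, g x = 1)
    (hfgh : ∀ x y, f x ^ a * g y ^ b ≤ h (a * x + b * y)) :
    (∫⁻ x, f x) ^ a * (∫⁻ x, g x) ^ b ≤ ∫⁻ x, h x := by
  refine (ENNReal.geom_mean_le_arith_mean2 ha hb hab _ _).trans ?_
  have hfle : ∀ x, f x ≤ 1 := fun x => hf1 ▸ le_iSup f x
  have hgle : ∀ x, g x ≤ 1 := fun x => hg1 ▸ le_iSup g x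
  -- Only levels t < 1 matter, since f and g are at most 1; truncating h makes the layer-cake
  -- formula applicable to it too.
  have hh1 : ∫⁻ x, min (h x) 1 ≤ ∫⁻ x, h x := lintegral_mono fun x => min_le_left _ _
  refine le_trans ?_ hh1
  rw [lintegral_eq_lintegral_meas_lt_of_le_one _ hf hfle,
    lintegral_eq_lintegral_meas_lt_of_le_one _ hg hgle,
    lintegral_eq_lintegral_meas_lt_of_le_one _ (hh.min measurable_const) fun x => min_le_right _ _]
  have hanti : ∀ k : ℝ → ℝ≥0∞, Measurable fun t : ℝ => volume {x | ENNReal.ofReal t < k x} :=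
    fun k => Antitone.measurable fun s t hst => measure_mono fun x hx =>
      lt_of_le_of_lt (ENNReal.ofReal_le_ofReal hst) hx
  rw [← lintegral_const_mul _ (hanti f), ← lintegral_const_mul _ (hanti g),
    ← lintegral_add_left ((hanti f).const_mul _)]
  refine setLIntegral_mono' measurableSet_Ioi fun t ht => ?_
  rw [Set.mem_Ioi] at ht
  rcases lt_or_ge t 1 with ht1 | ht1
  · have hT1 : ENNReal.ofReal t < 1 := by simpa using ht1
    have hT0 : ENNReal.ofReal t ≠ 0 := by simpa using ht
    refine volume_convex_comb_le (measurableSet_lt measurable_const hf)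
      (measurableSet_lt measurable_const hg) ?_ ?_ ha hb ?_
    · exact lt_iSup_iff.1 (hf1 ▸ hT1)
    · exact lt_iSup_iff.1 (hg1 ▸ hT1)
    · intro x hx y hy
      refine lt_min (lt_of_lt_of_le ?_ (hfgh x y)) hT1
      calc ENNReal.ofReal t = ENNReal.ofReal t ^ a * ENNReal.ofReal t ^ b := by
            rw [← ENNReal.rpow_add _ _ hT0 ENNReal.ofReal_ne_top, hab, ENNReal.rpow_one]
        _ < f x ^ a * g y ^ b :=
            ENNReal.mul_lt_mul (ENNReal.rpow_lt_rpow hx ha) (ENNReal.rpow_lt_rpow hy hb)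
  · have hempty : ∀ k : ℝ → ℝ≥0∞, (∀ x, k x ≤ 1) → {x | ENNReal.ofReal t < k x} = ∅ := by
      intro k hk
      ext x
      simpa using (hk x).trans (by simpa using ht1)
    rw [hempty f hfle, hempty g hgle]
    simp

/-- The inequality is homogeneous, so dividing f and g by their suprema M and N, and h by M^a N^b,
reduces to supremum 1. -/
lemma prekopa_leindler_real_of_iSup_ne_top {a b : ℝ} (ha : 0 < a) (hb : 0 < b) (hab : a + b = 1)
    {f g h : ℝ → ℝ≥0∞} (hf : Measurable f) (hg : Measurable g) (hh : Measurable h)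
    (hf1 : ⨆ x, f x ≠ ⊤) (hg1 : ⨆ x, g x ≠ ⊤)
    (hfgh : ∀ x y, f x ^ a * g y ^ b ≤ h (a * x + b * y)) :
    (∫⁻ x, f x) ^ a * (∫⁻ x, g x) ^ b ≤ ∫⁻ x, h x := by
  set M := ⨆ x, f x with hM
  set N := ⨆ x, g x with hN
  by_cases hM0 : M = 0
  · have : ∀ x, f x = 0 := by simpa [hM] using hM0
    simp [this, ENNReal.zero_rpow_of_pos ha]
  by_cases hN0 : N = 0
  · have : ∀ x, g x = 0 := by simpa [hN] using hN0
    simp [this, ENNReal.zero_rpow_of_pos hb]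
  have hP0 : M ^ a * N ^ b ≠ 0 := by
    simp [hM0, hN0, hf1, hg1]
  have hPt : M ^ a * N ^ b ≠ ⊤ :=
    ENNReal.mul_ne_top (ENNReal.rpow_ne_top_of_nonneg ha.le hf1)
      (ENNReal.rpow_ne_top_of_nonneg hb.le hg1)
  have hinv : (M ^ a * N ^ b)⁻¹ = M⁻¹ ^ a * N⁻¹ ^ b := by
    rw [ENNReal.mul_inv (by simp [hM0, hf1]) (by simp [hM0, hf1]), ENNReal.inv_rpow,
      ENNReal.inv_rpow]
  have := prekopa_leindler_real_of_iSup_eq_one ha hb hab (f := fun x => M⁻¹ * f x)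
    (g := fun x => N⁻¹ * g x) (h := fun x => (M ^ a * N ^ b)⁻¹ * h x)
    (hf.const_mul _) (hg.const_mul _) (hh.const_mul _)
    (by rw [← ENNReal.mul_iSup, ← hM, ENNReal.inv_mul_cancel hM0 hf1])
    (by rw [← ENNReal.mul_iSup, ← hN, ENNReal.inv_mul_cancel hN0 hg1])
    (fun x y => by
      rw [ENNReal.mul_rpow_of_nonneg _ _ ha.le, ENNReal.mul_rpow_of_nonneg _ _ hb.le,
        mul_mul_mul_comm, hinv]
      gcongr
      exact hfgh x y)
  rw [lintegral_const_mul _ hf, lintegral_const_mul _ hg, lintegral_const_mul _ hh,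
    ENNReal.mul_rpow_of_nonneg _ _ ha.le, ENNReal.mul_rpow_of_nonneg _ _ hb.le,
        mul_mul_mul_comm, ← hinv] at this
  rwa [ENNReal.mul_le_mul_iff_right (ENNReal.inv_ne_zero.2 hPt) (ENNReal.inv_ne_top.2 hP0)] at this

lemma lintegral_eq_iSup_lintegral_min_natCast {α : Type*} [MeasurableSpace α] (μ : Measure α)
    {f : α → ℝ≥0∞} (hf : Measurable f) :
    ∫⁻ x, f x ∂μ = ⨆ k : ℕ, ∫⁻ x, min (f x) k ∂μ := by
  rw [← lintegral_iSup (fun k => hf.min measurable_const) (fun i j hij x =>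
    min_le_min le_rfl (by exact_mod_cast hij))]
  refine lintegral_congr fun x => ?_
  rw [← inf_iSup_eq, ENNReal.iSup_natCast, inf_top_eq]

/-- One-dimensional Prékopa–Leindler inequality. -/
lemma prekopa_leindler_real {a b : ℝ} (ha : 0 < a) (hb : 0 < b) (hab : a + b = 1)
    {f g h : ℝ → ℝ≥0∞} (hf : Measurable f) (hg : Measurable g) (hh : Measurable h)
    (hfgh : ∀ x y, f x ^ a * g y ^ b ≤ h (a * x + b * y)) :
    (∫⁻ x, f x) ^ a * (∫⁻ x, g x) ^ b ≤ ∫⁻ x, h x := by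
  have hbdd : ∀ (k : ℝ → ℝ≥0∞) (m : ℕ), ⨆ x, min (k x) m ≠ ⊤ := fun k m =>
    ne_top_of_le_ne_top (ENNReal.natCast_ne_top m) (iSup_le fun x => min_le_right _ _)
  have hmono : ∀ k : ℝ → ℝ≥0∞, Monotone fun m : ℕ => ∫⁻ x, min (k x) m := fun k i j hij =>
    lintegral_mono fun x => min_le_min le_rfl (by exact_mod_cast hij)
  have key : ∀ m : ℕ, (∫⁻ x, min (f x) m) ^ a * (∫⁻ x, min (g x) m) ^ b ≤ ∫⁻ x, h x := fun m =>
    prekopa_leindler_real_of_iSup_ne_top ha hb hab (hf.min measurable_const)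
      (hg.min measurable_const) hh (hbdd f m) (hbdd g m) fun x y => le_trans
        (mul_le_mul' (ENNReal.rpow_le_rpow (min_le_left _ _) ha.le)
          (ENNReal.rpow_le_rpow (min_le_left _ _) hb.le)) (hfgh x y)
  have hF := (tendsto_atTop_iSup (hmono f))
  have hG := (tendsto_atTop_iSup (hmono g))
  rw [← lintegral_eq_iSup_lintegral_min_natCast _ hf] at hF
  rw [← lintegral_eq_iSup_lintegral_min_natCast _ hg] at hG
  -- Vanishing integrals are set aside because multiplication is not continuous at (0, ∞).
  by_cases hf0 : ∫⁻ x, f x = 0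
  · simp [hf0, ENNReal.zero_rpow_of_pos ha]
  by_cases hg0 : ∫⁻ x, g x = 0
  · simp [hg0, ENNReal.zero_rpow_of_pos hb]
  refine le_of_tendsto' (ENNReal.Tendsto.mul (hF.ennrpow_const a) (Or.inl ?_)
    (hG.ennrpow_const b) (Or.inl ?_)) key
  · simp [hf0, ha.not_gt]
  · simp [hg0, hb.not_gt]

/-- Prékopa–Leindler inequality on `Fin n → ℝ`. -/
lemma prekopa_leindler_pi {a b : ℝ} (ha : 0 < a) (hb : 0 < b) (hab : a + b = 1) (n : ℕ)
    {f g h : (Fin n → ℝ) → ℝ≥0∞} (hf : Measurable f) (hg : Measurable g) (hh : Measurable h)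
    (hfgh : ∀ x y, f x ^ a * g y ^ b ≤ h (a • x + b • y)) :
    (∫⁻ x, f x) ^ a * (∫⁻ x, g x) ^ b ≤ ∫⁻ x, h x := by
  induction n with
  | zero =>
    have h0 : ∀ k : (Fin 0 → ℝ) → ℝ≥0∞, ∫⁻ x, k x = k 0 := fun k => by
      rw [volume_pi, Measure.pi_of_empty (x := 0), lintegral_dirac]
    simpa [h0] using hfgh 0 0
  | succ n ih =>
    have hmp := (volume_preserving_piFinSuccAbove (fun _ : Fin (n + 1) => ℝ) 0).symm
    have hfub : ∀ k : (Fin (n + 1) → ℝ) → ℝ≥0∞, Measurable k →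
        ∫⁻ x, k x = ∫⁻ s : ℝ, ∫⁻ y : Fin n → ℝ, k (Fin.cons s y) := fun k hk => by
      rw [← hmp.lintegral_comp hk, Measure.volume_eq_prod, lintegral_prod]
      · simp [MeasurableEquiv.piFinSuccAbove, Fin.insertNthEquiv]
      · exact (hk.comp hmp.measurable).aemeasurable
    have hcons : Measurable fun p : ℝ × (Fin n → ℝ) => (Fin.cons p.1 p.2 : Fin (n + 1) → ℝ) := by
      have := hmp.measurable
      simpa [MeasurableEquiv.piFinSuccAbove, Fin.insertNthEquiv] using this
    have hmeas : ∀ k : (Fin (n + 1) → ℝ) → ℝ≥0∞, Measurable k →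
        Measurable fun s : ℝ => ∫⁻ y : Fin n → ℝ, k (Fin.cons s y) := fun k hk =>
      Measurable.lintegral_prod_right' (f := fun p : ℝ × (Fin n → ℝ) => k (Fin.cons p.1 p.2))
        (hk.comp hcons)
    have hsec : ∀ k : (Fin (n + 1) → ℝ) → ℝ≥0∞, Measurable k → ∀ s : ℝ,
        Measurable fun y : Fin n → ℝ => k (Fin.cons s y) := fun k hk s =>
      (hk.comp hcons).comp (measurable_const.prodMk measurable_id)
    rw [hfub f hf, hfub g hg, hfub h hh]
    -- The slice integrals satisfy the one-dimensional hypothesis by the induction hypothesis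
    -- applied to the slices.
    refine prekopa_leindler_real ha hb hab (hmeas f hf) (hmeas g hg) (hmeas h hh) fun s t => ?_
    refine ih (hsec f hf s) (hsec g hg t) (hsec h hh _) fun x y => ?_
    convert hfgh (Fin.cons s x) (Fin.cons t y) using 2
    ext i
    refine Fin.cases ?_ (fun j => ?_) i <;> simp

/-- Prékopa–Leindler inequality on Euclidean space. -/
theorem prekopa_leindler {a b : ℝ} (ha : 0 < a) (hb : 0 < b) (hab : a + b = 1) {n : ℕ}
    {f g h : EuclideanSpace ℝ (Fin n) → ℝ≥0∞} (hf : Measurable f) (hg : Measurable g)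
    (hh : Measurable h) (hfgh : ∀ x y, f x ^ a * g y ^ b ≤ h (a • x + b • y)) :
    (∫⁻ x, f x) ^ a * (∫⁻ x, g x) ^ b ≤ ∫⁻ x, h x := by
  have hmp := PiLp.volume_preserving_toLp (Fin n)
  rw [← hmp.lintegral_comp hf, ← hmp.lintegral_comp hg, ← hmp.lintegral_comp hh]
  exact prekopa_leindler_pi ha hb hab n (hf.comp hmp.measurable) (hg.comp hmp.measurable)
    (hh.comp hmp.measurable) fun x y => hfgh _ _

/-! ### Grünbaum's inequality on the line -/

/-- If `T` is the tail function of `m`, then `T` is stochastically larger than uniform. -/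
lemma measure_setOf_tail_le (m : Measure ℝ) [IsFiniteMeasure m] (q : ℝ≥0∞) :
    m {s | m (Set.Ici s) ≤ q} ≤ q := by
  have hanti : Antitone fun s => m (Set.Ici s) := fun s t hst =>
    measure_mono (Set.Ici_subset_Ici.2 hst)
  have hmeas : MeasurableSet {s | m (Set.Ici s) ≤ q} :=
    measurableSet_le hanti.measurable measurable_const
  -- A compact C inside the set is contained in the ray from its minimum, which itself belongs to
  -- the set.
  rw [hmeas.measure_eq_iSup_isCompact]
  refine iSup₂_le fun C hC => iSup_le fun hCc => ?_
  rcases C.eq_empty_or_nonempty with rfl | hne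
  · simp
  · exact (measure_mono fun y hy => csInf_le hCc.bddBelow hy).trans (hC (hCc.sInf_mem hne))

/-- If Y has law `m` and tail function T, then T(Y) dominates a uniform variable, so -log T(Y) is
dominated by a standard exponential, whose mean is 1. -/
lemma lintegral_neg_log_tail_le_one (m : Measure ℝ) [IsProbabilityMeasure m] :
    ∫⁻ y, ENNReal.ofReal (-Real.log (m.real (Set.Ici y))) ∂m ≤ 1 := by
  have hanti : Antitone fun s => m.real (Set.Ici s) := fun s t hst =>
    measureReal_mono (Set.Ici_subset_Ici.2 hst)
  rw [lintegral_eq_lintegral_meas_le m (Filter.Eventually.of_forall fun y => ?_)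
    (f := fun y => -Real.log (m.real (Set.Ici y)))
    (Real.measurable_log.comp hanti.measurable).neg.aemeasurable]
  · have h1 : ∫⁻ r in Set.Ioi (0 : ℝ), ENNReal.ofReal (Real.exp (-r)) = 1 := by
      rw [← ofReal_integral_eq_lintegral_ofReal]
      · rw [integral_exp_neg_Ioi_zero, ENNReal.ofReal_one]
      · exact integrableOn_exp_neg_Ioi 0
      · exact Filter.Eventually.of_forall fun r => (Real.exp_pos _).le
    rw [← h1]
    refine setLIntegral_mono' measurableSet_Ioi fun r hr => ?_
    refine le_trans (measure_mono fun y hy => ?_) (measure_setOf_tail_le m _)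
    change m (Set.Ici y) ≤ _
    change r ≤ -Real.log (m.real (Set.Ici y)) at hy
    rw [← ofReal_measureReal]
    refine ENNReal.ofReal_le_ofReal ?_
    rcases (measureReal_nonneg (μ := m) (s := Set.Ici y)).eq_or_lt with h0 | h0
    · rw [← h0]; positivity
    · rw [← Real.log_le_iff_le_exp h0]
      linarith
  · exact neg_nonneg.2 (Real.log_nonpos measureReal_nonneg measureReal_le_one)

lemma ConvexOn.exists_add_mul_le {D : Set ℝ} {φ : ℝ → ℝ} (hφ : ConvexOn ℝ D φ) {x : ℝ}
    (hx : x ∈ interior D) : ∃ c : ℝ, ∀ y ∈ D, φ x + c * (y - x) ≤ φ y := by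
  refine ⟨derivWithin φ (Set.Ioi x) x, fun y hy => ?_⟩
  rcases lt_trichotomy y x with hyx | rfl | hyx
  · have h1 := (hφ.slope_le_leftDeriv_of_mem_interior hy hx hyx).trans
      (hφ.leftDeriv_le_rightDeriv_of_mem_interior hx)
    rw [slope_def_field, div_le_iff₀ (by linarith)] at h1
    linarith
  · simp
  · have h1 := hφ.rightDeriv_le_slope_of_mem_interior hx hy hyx
    rw [slope_def_field, le_div_iff₀ (by linarith)] at h1
    linarith

/-- Grünbaum's inequality for a centered probability measure on the line with log-concave tail. -/
theorem exp_neg_one_le_measureReal_Ici (m : Measure ℝ) [IsProbabilityMeasure m]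
    (hint : Integrable (fun y : ℝ => y) m) (hmean : ∫ y, y ∂m = 0)
    (hlc : ∀ s t a b : ℝ, 0 < a → 0 < b → a + b = 1 →
      m (Set.Ici s) ^ a * m (Set.Ici t) ^ b ≤ m (Set.Ici (a * s + b * t))) :
    Real.exp (-1) ≤ m.real (Set.Ici 0) := by
  set T : ℝ → ℝ := fun s => m.real (Set.Ici s) with hT
  have hanti : Antitone T := fun s t hst => measureReal_mono (Set.Ici_subset_Ici.2 hst)
  -- A positive tail beyond 0 puts 0 in the interior of {T > 0}. Otherwise `m` lives on y ≤ 0 and,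
  -- having mean 0, is the point mass at 0.
  by_cases hpos : ∃ s > 0, 0 < T s
  swap
  · push Not at hpos
    have hle : ∀ᵐ y ∂m, y ≤ 0 := by
      have : ∀ᵐ y ∂m, ∀ k : ℕ, y < 1 / ((k : ℝ) + 1) := ae_all_iff.2 fun k => by
        have h0 : T (1 / ((k : ℝ) + 1)) = 0 :=
          le_antisymm (hpos _ (by positivity)) measureReal_nonneg
        rw [hT, measureReal_eq_zero_iff] at h0
        rw [ae_iff]
        simpa [Set.Ici] using h0
      filter_upwards [this] with y hy
      refine le_of_forall_pos_lt_add fun ε hε => ?_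
      obtain ⟨k, hk⟩ := exists_nat_one_div_lt hε
      linarith [hy k]
    have hzero : (fun y : ℝ => -y) =ᵐ[m] 0 := by
      refine (integral_eq_zero_iff_of_nonneg_ae
        (by filter_upwards [hle] with y hy; simpa using hy) hint.neg).1 ?_
      rw [integral_neg', hmean, neg_zero]
    have h1 : m (Set.Ici 0) = 1 := by
      rw [prob_compl_eq_zero_iff measurableSet_Ici |>.symm]
      refine measure_mono_null (t := {y | ¬ (-y = 0)}) (fun y hy => ?_) (ae_iff.1 hzero)
      simp only [Set.mem_compl_iff, Set.mem_Ici, not_le] at hy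
      simpa using hy.ne
    simp [measureReal_def, h1]
  obtain ⟨s₀, hs₀, hTs₀⟩ := hpos
  have hconv : ConvexOn ℝ {s | 0 < T s} fun s => -Real.log (T s) := by
    refine convexOn_iff_forall_pos.2 ⟨?_, ?_⟩
    · refine Set.OrdConnected.convex ⟨fun x _ y hy z hz => ?_⟩
      exact lt_of_lt_of_le (Set.mem_ofPred.1 hy) (hanti hz.2)
    · intro s hs t ht a b ha hb hab
      have h1 := ENNReal.toReal_mono (measure_ne_top _ _) (hlc s t a b ha hb hab)
      rw [ENNReal.toReal_mul, ← ENNReal.toReal_rpow, ← ENNReal.toReal_rpow] at h1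
      change T s ^ a * T t ^ b ≤ T (a * s + b * t) at h1
      rw [Set.mem_ofPred] at hs ht
      have h2 := Real.log_le_log (by positivity) h1
      rw [Real.log_mul (by positivity) (by positivity), Real.log_rpow hs, Real.log_rpow ht] at h2
      simp only [smul_eq_mul]
      linarith
  have h0 : (0 : ℝ) ∈ interior {s | 0 < T s} :=
    mem_interior.2 ⟨Set.Iio s₀, fun y hy => lt_of_lt_of_le hTs₀ (hanti (le_of_lt hy)),
      isOpen_Iio, hs₀⟩
  -- Integrating the supporting line of -log T at 0 kills the slope term, as the mean is 0: -log
  -- T(0) ≤ ∫ -log T ≤ 1.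
  obtain ⟨c, hc⟩ := hconv.exists_add_mul_le h0
  have hae : ∀ᵐ y ∂m, 0 < T y := by
    rw [ae_iff]
    have := measure_setOf_tail_le m 0
    refine le_antisymm (le_trans (measure_mono fun y hy => ?_) this) zero_le
    have : T y = 0 := le_antisymm (not_lt.1 hy) measureReal_nonneg
    rw [hT, measureReal_eq_zero_iff] at this
    exact this.le
  have hnn : ∀ y, 0 ≤ -Real.log (T y) := fun y =>
    neg_nonneg.2 (Real.log_nonpos measureReal_nonneg measureReal_le_one)
  have hmeas : AEStronglyMeasurable (fun y => -Real.log (T y)) m :=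
    (Real.measurable_log.comp hanti.measurable).neg.aestronglyMeasurable
  have hlint := lintegral_neg_log_tail_le_one m
  have hI : Integrable (fun y => -Real.log (T y)) m :=
    ⟨hmeas, (hasFiniteIntegral_iff_ofReal (Filter.Eventually.of_forall hnn)).2
      (hlint.trans_lt ENNReal.one_lt_top)⟩
  have hE : ∫ y, -Real.log (T y) ∂m ≤ 1 := by
    rw [integral_eq_lintegral_of_nonneg_ae (Filter.Eventually.of_forall hnn) hmeas]
    exact ENNReal.toReal_le_of_le_ofReal zero_le_one (by simpa using hlint)
  have hJ : ∫ y, (-Real.log (T 0) + c * (y - 0)) ∂m ≤ ∫ y, -Real.log (T y) ∂m := by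
    refine integral_mono_ae ?_ hI ?_
    · simp only [sub_zero]
      exact (integrable_const (-Real.log (T 0))).add (hint.const_mul c)
    · filter_upwards [hae] with y hy using hc y hy
  have hK : ∫ y, (-Real.log (T 0) + c * (y - 0)) ∂m = -Real.log (T 0) := by
    simp only [sub_zero]
    rw [integral_add (integrable_const _) (hint.const_mul c), integral_const_mul, hmean]
    simp
  rw [hK] at hJ
  rw [← Real.le_log_iff_exp_le (interior_subset h0 : (0 : ℝ) ∈ {s | 0 < T s})]
  linarith

/-! ### Exponential integrals over a convex body and their minimizers -/

lemma setLIntegral_exp_inner_log_concave {n : ℕ} (ξ : EuclideanSpace ℝ (Fin n))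
    {A B C : Set (EuclideanSpace ℝ (Fin n))} (hA : MeasurableSet A) (hB : MeasurableSet B)
    (hC : MeasurableSet C) {a b : ℝ} (ha : 0 < a) (hb : 0 < b) (hab : a + b = 1)
    (h : ∀ x ∈ A, ∀ y ∈ B, a • x + b • y ∈ C) :
    (∫⁻ z in A, ENNReal.ofReal (Real.exp (inner ℝ ξ z))) ^ a *
      (∫⁻ z in B, ENNReal.ofReal (Real.exp (inner ℝ ξ z))) ^ b ≤
      ∫⁻ z in C, ENNReal.ofReal (Real.exp (inner ℝ ξ z)) := by
  have hw : Measurable fun z : EuclideanSpace ℝ (Fin n) =>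
      ENNReal.ofReal (Real.exp (inner ℝ ξ z)) := by fun_prop
  rw [← lintegral_indicator hA, ← lintegral_indicator hB, ← lintegral_indicator hC]
  refine prekopa_leindler ha hb hab (hw.indicator hA) (hw.indicator hB) (hw.indicator hC)
    fun x y => ?_
  by_cases hx : x ∈ A
  swap
  · simp [hx, ENNReal.zero_rpow_of_pos ha]
  by_cases hy : y ∈ B
  swap
  · simp [hy, ENNReal.zero_rpow_of_pos hb]
  rw [Set.indicator_of_mem hx, Set.indicator_of_mem hy, Set.indicator_of_mem (h x hx y hy),
    ENNReal.ofReal_rpow_of_pos (Real.exp_pos _), ENNReal.ofReal_rpow_of_pos (Real.exp_pos _),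
    ← ENNReal.ofReal_mul (by positivity), ← Real.exp_mul, ← Real.exp_mul, ← Real.exp_add,
    inner_add_right, real_inner_smul_right, real_inner_smul_right, mul_comm a, mul_comm b]

lemma setLIntegral_smul_set {n : ℕ} {A : Set (EuclideanSpace ℝ (Fin n))} (hA : MeasurableSet A)
    (g : EuclideanSpace ℝ (Fin n) → ℝ≥0∞) {s : ℝ} (hs : 0 < s) :
    ∫⁻ y in (fun z => s • z) '' A, g y = ENNReal.ofReal (s ^ n) * ∫⁻ z in A, g (s • z) := by
  rw [lintegral_image_eq_lintegral_abs_det_fderiv_mul volume hA (f := fun z => s • z)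
    (f' := fun _ => s • ContinuousLinearMap.id ℝ (EuclideanSpace ℝ (Fin n)))
    (fun x _ => ((hasFDerivAt_id x).const_smul s).hasFDerivWithinAt)
    (smul_right_injective _ hs.ne').injOn]
  have hdet : (s • ContinuousLinearMap.id ℝ (EuclideanSpace ℝ (Fin n))).det = s ^ n := by
    rw [ContinuousLinearMap.det, ContinuousLinearMap.toLinearMap_smul, LinearMap.det_smul]
    simp
  rw [hdet, abs_of_pos (by positivity), lintegral_const_mul' _ _ ENNReal.ofReal_ne_top]

/-- The integral over `K` of the exponential of the linear form `⟨ξ, ·⟩`. -/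
noncomputable def expIntegral {n : ℕ} (K : Set (EuclideanSpace ℝ (Fin n)))
    (ξ : EuclideanSpace ℝ (Fin n)) : ℝ :=
  ∫ z in K, Real.exp (inner ℝ ξ z)

section

variable {n : ℕ} {K : Set (EuclideanSpace ℝ (Fin n))}

lemma integrableOn_exp_inner (hK : IsCompact K) (ξ : EuclideanSpace ℝ (Fin n)) :
    IntegrableOn (fun z => Real.exp (inner ℝ ξ z)) K :=
  ContinuousOn.integrableOn_compact hK (by fun_prop)

lemma ofReal_expIntegral (hK : IsCompact K) (ξ : EuclideanSpace ℝ (Fin n)) :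
    ENNReal.ofReal (expIntegral K ξ) = ∫⁻ z in K, ENNReal.ofReal (Real.exp (inner ℝ ξ z)) :=
  ofReal_integral_eq_lintegral_ofReal (integrableOn_exp_inner hK ξ)
    (Filter.Eventually.of_forall fun _ => (Real.exp_pos _).le)

lemma volume_ne_zero_of_nonempty_interior (hK : (interior K).Nonempty) : volume K ≠ 0 :=
  fun h => (isOpen_interior.measure_pos volume hK).ne'
    (measure_mono_null interior_subset h)

lemma expIntegral_pos (hK : IsCompact K) (hK0 : (interior K).Nonempty)
    (ξ : EuclideanSpace ℝ (Fin n)) : 0 < expIntegral K ξ := by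
  have : NeZero (volume.restrict K) := ⟨by
    simpa [Measure.restrict_eq_zero] using volume_ne_zero_of_nonempty_interior hK0⟩
  exact integral_exp_pos (integrableOn_exp_inner hK ξ)

lemma continuous_expIntegral (hK : IsCompact K) : Continuous (expIntegral K) :=
  continuous_parametric_integral_of_continuous
    (f := fun ξ z : EuclideanSpace ℝ (Fin n) => Real.exp (inner ℝ ξ z)) (by fun_prop) hK

/-- Coercivity: K contains a small ball displaced from 0 in the direction of ξ, and there ⟨ξ,z⟩ is
at least a fixed multiple of ‖ξ‖. -/
lemma exists_mul_exp_le_expIntegral (hK : IsCompact K) (h0 : (0 : EuclideanSpace ℝ (Fin n)) ∈ interior K) :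
    ∃ c > 0, ∃ r > 0, ∀ ξ, c * Real.exp (r * ‖ξ‖) ≤ expIntegral K ξ := by
  obtain ⟨r, hr, hball⟩ := Metric.mem_nhds_iff.1 (mem_interior_iff_mem_nhds.1 h0)
  refine ⟨volume.real (Metric.ball (0 : EuclideanSpace ℝ (Fin n)) (r / 4)), ?_, r / 2, by positivity,
    fun ξ => ?_⟩
  · exact ENNReal.toReal_pos (Metric.measure_ball_pos _ _ (by positivity)).ne'
      measure_ball_lt_top.ne
  -- The ball of radius r/4 about `p` stays within radius r of 0, and on it ⟨ξ,z⟩ ≥ (3r/4 - r/4)‖ξ‖.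
  -- For ξ = 0 the convention 0⁻¹ = 0 gives `p = 0`.
  set p : EuclideanSpace ℝ (Fin n) := (3 * r / 4) • (‖ξ‖⁻¹ • ξ) with hp
  have hpn : ‖p‖ ≤ 3 * r / 4 := by
    rw [hp, norm_smul, norm_smul, norm_inv, norm_norm, Real.norm_of_nonneg (by positivity)]
    have : ‖ξ‖⁻¹ * ‖ξ‖ ≤ 1 := inv_mul_le_one
    nlinarith
  have hpξ : inner ℝ ξ p = 3 * r / 4 * ‖ξ‖ := by
    rw [hp, real_inner_smul_right, real_inner_smul_right, real_inner_self_eq_norm_sq]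
    rcases eq_or_ne ‖ξ‖ 0 with h | h
    · simp [h]
    · field_simp
  have hsub : Metric.ball p (r / 4) ⊆ K := fun z hz => hball <| by
    rw [mem_ball_iff_norm] at hz
    rw [mem_ball_zero_iff]
    have := norm_add_le (z - p) p
    rw [sub_add_cancel] at this
    linarith
  have hlow : ∀ z ∈ Metric.ball p (r / 4), Real.exp (r / 2 * ‖ξ‖) ≤ Real.exp (inner ℝ ξ z) := by
    intro z hz
    rw [mem_ball_iff_norm] at hz
    refine Real.exp_le_exp.2 ?_
    have h1 : inner ℝ ξ z = inner ℝ ξ p + inner ℝ ξ (z - p) := by rw [← inner_add_right]; simp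
    have h2 := (abs_le.1 (abs_real_inner_le_norm ξ (z - p))).1
    have h3 := mul_le_mul_of_nonneg_left hz.le (norm_nonneg ξ)
    rw [h1, hpξ]
    linarith
  calc _ = ∫ _ in Metric.ball p (r / 4), Real.exp (r / 2 * ‖ξ‖) := by
        rw [setIntegral_const, smul_eq_mul, measureReal_def, measureReal_def,
          Measure.addHaar_ball_center volume p]
    _ ≤ ∫ z in Metric.ball p (r / 4), Real.exp (inner ℝ ξ z) :=
        setIntegral_mono_on (integrableOn_const measure_ball_lt_top.ne)
          ((integrableOn_exp_inner hK ξ).mono_set hsub) measurableSet_ball hlow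
    _ ≤ _ := setIntegral_mono_set (integrableOn_exp_inner hK ξ)
        (Filter.Eventually.of_forall fun _ => (Real.exp_pos _).le) hsub.eventuallyLE

lemma exists_expIntegral_le (hK : IsCompact K)
    (h0 : (0 : EuclideanSpace ℝ (Fin n)) ∈ interior K) :
    ∃ ξ, ∀ η, expIntegral K ξ ≤ expIntegral K η := by
  obtain ⟨c, hc, r, hr, h⟩ := exists_mul_exp_le_expIntegral hK h0
  refine (continuous_expIntegral hK).exists_forall_le (Filter.tendsto_atTop_mono h ?_)
  exact (Real.tendsto_exp_atTop.comp
    ((tendsto_norm_cocompact_atTop).const_mul_atTop hr)).const_mul_atTop hc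

/-- By scaling, s^n F(sξ) is the integral of e^{⟨ξ,·⟩} over sK, and convexity puts a·sK + b·tK
inside (as + bt)K; Prékopa–Leindler does the rest. -/
lemma expIntegral_smul_log_concave (hK : IsCompact K) (hKc : Convex ℝ K)
    (ξ : EuclideanSpace ℝ (Fin n)) {s t a b : ℝ} (hs : 0 < s) (ht : 0 < t) (ha : 0 < a)
    (hb : 0 < b) (hab : a + b = 1) :
    (s ^ n * expIntegral K (s • ξ)) ^ a * (t ^ n * expIntegral K (t • ξ)) ^ b ≤
      (a * s + b * t) ^ n * expIntegral K ((a * s + b * t) • ξ) := by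
  have hnn : ∀ η, 0 ≤ expIntegral K η := fun η => integral_nonneg fun _ => (Real.exp_pos _).le
  have hscale : ∀ q : ℝ, 0 < q → ∫⁻ z in (fun z => q • z) '' K,
      ENNReal.ofReal (Real.exp (inner ℝ ξ z)) =
      ENNReal.ofReal (q ^ n * expIntegral K (q • ξ)) := fun q hq => by
    rw [setLIntegral_smul_set hK.measurableSet _ hq, ENNReal.ofReal_mul (by positivity),
      ofReal_expIntegral hK]
    simp only [real_inner_smul_left, real_inner_smul_right]
  have hmeas : ∀ q : ℝ, MeasurableSet ((fun z : EuclideanSpace ℝ (Fin n) => q • z) '' K) :=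
    fun q => (hK.image (continuous_const_smul q)).measurableSet
  have hq : 0 < a * s + b * t := by positivity
  have := setLIntegral_exp_inner_log_concave ξ (hmeas s) (hmeas t) (hmeas (a * s + b * t))
    ha hb hab (by
      rintro _ ⟨x, hx, rfl⟩ _ ⟨y, hy, rfl⟩
      refine ⟨(a * s + b * t)⁻¹ • ((a * s) • x + (b * t) • y), ?_, ?_⟩
      · rw [smul_add, smul_smul, smul_smul]
        exact hKc hx hy (by positivity) (by positivity) (by field_simp)
      · simp only [smul_smul, smul_inv_smul₀ hq.ne'])
  rw [hscale s hs, hscale t ht, hscale _ hq,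
    ENNReal.ofReal_rpow_of_nonneg (mul_nonneg (by positivity) (hnn _)) ha.le,
    ENNReal.ofReal_rpow_of_nonneg (mul_nonneg (by positivity) (hnn _)) hb.le,
    ← ENNReal.ofReal_mul (Real.rpow_nonneg (mul_nonneg (by positivity) (hnn _)) _),
    ENNReal.ofReal_le_ofReal_iff (mul_nonneg (by positivity) (hnn _))] at this
  exact this

lemma mem_interior_integrableExpSet_of_continuous (hK : IsCompact K)
    {f : EuclideanSpace ℝ (Fin n) → ℝ} (hf : Continuous f) (t : ℝ) :
    t ∈ interior (ProbabilityTheory.integrableExpSet f (volume.restrict K)) := by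
  have : ProbabilityTheory.integrableExpSet f (volume.restrict K) = Set.univ :=
    Set.eq_univ_of_forall fun t => ContinuousOn.integrableOn_compact hK (by fun_prop)
  simp [this]

/-- At a minimizer `ξ` of `expIntegral K`, its growth along the ray through `ξ` is controlled. -/
lemma expIntegral_smul_le (hK : IsCompact K) (hKc : Convex ℝ K) (hK0 : (interior K).Nonempty)
    {ξ : EuclideanSpace ℝ (Fin n)} (hξ : ∀ η, expIntegral K ξ ≤ expIntegral K η) {r : ℝ}
    (hr : 0 < r) :
    expIntegral K ((1 + r) • ξ) ≤ expIntegral K ξ * Real.exp (n * r ^ 2 / 2) := by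
  have hpos := expIntegral_pos hK hK0
  set F : ℝ → ℝ := fun s => expIntegral K (s • ξ) with hF
  have hFmgf : F = ProbabilityTheory.mgf (fun z => inner ℝ ξ z) (volume.restrict K) := by
    ext s
    simp [hF, expIntegral, ProbabilityTheory.mgf, real_inner_smul_left]
  have hderiv : HasDerivAt F 0 1 := by
    have hd : DifferentiableAt ℝ F 1 := by
      rw [hFmgf]
      exact ProbabilityTheory.differentiableAt_mgf
        (mem_interior_integrableExpSet_of_continuous hK (by fun_prop) 1)
    have hmin : IsLocalMin F 1 := Filter.Eventually.of_forall fun s => by simpa [hF] using hξ (s • ξ)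
    have := hd.hasDerivAt
    rwa [hmin.deriv_eq_zero] at this
  have hconc : ConcaveOn ℝ (Set.Ioi 0) fun s => n * Real.log s + Real.log (F s) := by
    refine concaveOn_iff_forall_pos.2 ⟨convex_Ioi 0, ?_⟩
    intro s hs t ht a b ha hb hab
    rw [Set.mem_Ioi] at hs ht
    have hFs := hpos (s • ξ)
    have hFt := hpos (t • ξ)
    have hq : 0 < a * s + b * t := by positivity
    have h1 := Real.log_le_log (by positivity)
      (expIntegral_smul_log_concave hK hKc ξ hs ht ha hb hab)
    rw [Real.log_mul (by positivity) (by positivity), Real.log_rpow (by positivity),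
      Real.log_rpow (by positivity), Real.log_mul (by positivity) (by positivity),
      Real.log_mul (by positivity) (by positivity),
      Real.log_mul (by positivity) (hpos _).ne', Real.log_pow, Real.log_pow, Real.log_pow] at h1
    exact h1
  have hd : HasDerivAt (fun s => n * Real.log s + Real.log (F s)) n 1 := by
    have hF1 : F 1 ≠ 0 := (hpos _).ne'
    convert! ((Real.hasDerivAt_log one_ne_zero).const_mul (n : ℝ)).add (hderiv.log hF1) using 1
    simp
  -- The concave function lies below its tangent at 1, whose slope is n because F is stationary
  -- there: n log(1+r) + log F(1+r) - log F(1) ≤ nr.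
  have hslope := hconc.slope_le_of_hasDerivAt (x := 1) (y := 1 + r) (by simp)
    (Set.mem_Ioi.2 (by linarith)) (by linarith) hd
  rw [slope_def_field, div_le_iff₀ (by linarith)] at hslope
  have hlog : r - r ^ 2 / 2 ≤ Real.log (1 + r) := by
    refine le_trans ?_ (Real.le_log_one_add_of_nonneg hr.le)
    rw [le_div_iff₀ (by positivity)]
    nlinarith [pow_pos hr 3]
  have hF1 : F 1 = expIntegral K ξ := by simp [hF]
  simp only [Real.log_one, mul_zero, zero_add, add_sub_cancel_left, hF1] at hslope
  have hn : (n : ℝ) * (r - r ^ 2 / 2) ≤ n * Real.log (1 + r) :=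
    mul_le_mul_of_nonneg_left hlog (Nat.cast_nonneg n)
  rw [← Real.exp_log (hpos ξ), ← Real.exp_add, ← Real.log_le_iff_le_exp (hpos _)]
  change Real.log (F (1 + r)) ≤ _
  linarith

end

/-! ### Tilted measures and the volume of half-space sections -/

section

variable {n : ℕ} {K : Set (EuclideanSpace ℝ (Fin n))}

/-- The uniform measure on `K`, tilted by the linear form `⟨ξ, ·⟩`. -/
noncomputable def tiltedUniform (K : Set (EuclideanSpace ℝ (Fin n)))
    (ξ : EuclideanSpace ℝ (Fin n)) : Measure (EuclideanSpace ℝ (Fin n)) :=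
  (volume.restrict K).tilted fun z => inner ℝ ξ z

lemma isProbabilityMeasure_tiltedUniform (hK : IsCompact K) (hK0 : (interior K).Nonempty)
    (ξ : EuclideanSpace ℝ (Fin n)) : IsProbabilityMeasure (tiltedUniform K ξ) := by
  have : NeZero (volume.restrict K) := ⟨by
    simpa [Measure.restrict_eq_zero] using volume_ne_zero_of_nonempty_interior hK0⟩
  exact isProbabilityMeasure_tilted (integrableOn_exp_inner hK ξ)

lemma tiltedUniform_apply (hK : IsCompact K) (hK0 : (interior K).Nonempty)
    (ξ : EuclideanSpace ℝ (Fin n)) {S : Set (EuclideanSpace ℝ (Fin n))} (hS : MeasurableSet S) :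
    tiltedUniform K ξ S = (ENNReal.ofReal (expIntegral K ξ))⁻¹ *
      ∫⁻ z in S ∩ K, ENNReal.ofReal (Real.exp (inner ℝ ξ z)) := by
  have hF := expIntegral_pos hK hK0 ξ
  rw [tiltedUniform, tilted_apply' _ _ hS, Measure.restrict_restrict hS,
    ← lintegral_const_mul' _ _ (by simpa using hF)]
  refine lintegral_congr fun z => ?_
  change ENNReal.ofReal (_ / expIntegral K ξ) = _
  rw [ENNReal.ofReal_div_of_pos hF, ENNReal.div_eq_inv_mul]

lemma integrable_exp_mul_inner_tiltedUniform (hK : IsCompact K) (ξ u : EuclideanSpace ℝ (Fin n))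
    (t : ℝ) : Integrable (fun z => Real.exp (t * inner ℝ u z)) (tiltedUniform K ξ) := by
  rw [tiltedUniform, integrable_tilted_iff (integrableOn_exp_inner hK ξ)]
  exact ContinuousOn.integrableOn_compact hK (by fun_prop)

lemma zero_mem_interior_integrableExpSet_tiltedUniform (hK : IsCompact K)
    (ξ u : EuclideanSpace ℝ (Fin n)) :
    0 ∈ interior (ProbabilityTheory.integrableExpSet (fun z => inner ℝ u z)
      (tiltedUniform K ξ)) := by
  have : ProbabilityTheory.integrableExpSet (fun z => inner ℝ u z) (tiltedUniform K ξ) =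
      Set.univ :=
    Set.eq_univ_of_forall fun t => integrable_exp_mul_inner_tiltedUniform hK ξ u t
  simp [this]

lemma mgf_tiltedUniform (ξ u : EuclideanSpace ℝ (Fin n)) (t : ℝ) :
    ProbabilityTheory.mgf (fun z => inner ℝ u z) (tiltedUniform K ξ) t =
      expIntegral K (ξ + t • u) / expIntegral K ξ := by
  rw [ProbabilityTheory.mgf, tiltedUniform, integral_exp_tilted]
  simp [expIntegral, inner_add_left, real_inner_smul_left]

/-- First-order condition at the minimizer: the mean of ⟨u,·⟩ is the derivative at 0 of t ↦ F(ξ +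
tu)/F(ξ). -/
lemma integral_inner_tiltedUniform (hK : IsCompact K) (hK0 : (interior K).Nonempty)
    {ξ : EuclideanSpace ℝ (Fin n)} (hξ : ∀ η, expIntegral K ξ ≤ expIntegral K η)
    (u : EuclideanSpace ℝ (Fin n)) : ∫ z, inner ℝ u z ∂tiltedUniform K ξ = 0 := by
  have hF := expIntegral_pos hK hK0 ξ
  have h := zero_mem_interior_integrableExpSet_tiltedUniform hK ξ u
  rw [← ProbabilityTheory.deriv_mgf_zero h]
  refine IsLocalMin.deriv_eq_zero (Filter.Eventually.of_forall fun t => ?_)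
  rw [mgf_tiltedUniform, mgf_tiltedUniform]
  gcongr
  simpa using hξ _

/-- Grünbaum's inequality for half-spaces through the barycenter of the tilted measure. -/
lemma exp_neg_one_le_tiltedUniform (hK : IsCompact K) (hKc : Convex ℝ K)
    (hK0 : (interior K).Nonempty) {ξ : EuclideanSpace ℝ (Fin n)}
    (hξ : ∀ η, expIntegral K ξ ≤ expIntegral K η) (u : EuclideanSpace ℝ (Fin n)) :
    Real.exp (-1) ≤ (tiltedUniform K ξ).real {z | 0 ≤ inner ℝ u z} := by
  have := isProbabilityMeasure_tiltedUniform hK hK0 ξ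
  have hu : Measurable fun z : EuclideanSpace ℝ (Fin n) => (inner ℝ u z : ℝ) := by fun_prop
  have hF := expIntegral_pos hK hK0 ξ
  set m := (tiltedUniform K ξ).map fun z => inner ℝ u z with hm
  have : IsProbabilityMeasure m := Measure.isProbabilityMeasure_map hu.aemeasurable
  have hint : Integrable (fun y : ℝ => y) m :=
    (integrable_map_measure (by fun_prop) hu.aemeasurable).2
      (ProbabilityTheory.integrable_of_mem_interior_integrableExpSet
        (zero_mem_interior_integrableExpSet_tiltedUniform hK ξ u))
  have hmean : ∫ y, y ∂m = 0 := by
    rw [hm, integral_map hu.aemeasurable (by fun_prop)]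
    exact integral_inner_tiltedUniform hK hK0 hξ u
  have hhalf : ∀ s : ℝ, MeasurableSet {z : EuclideanSpace ℝ (Fin n) | s ≤ inner ℝ u z} :=
    fun s => measurableSet_le measurable_const hu
  have htail : ∀ s, m (Set.Ici s) = (ENNReal.ofReal (expIntegral K ξ))⁻¹ *
      ∫⁻ z in {z | s ≤ inner ℝ u z} ∩ K, ENNReal.ofReal (Real.exp (inner ℝ ξ z)) := fun s => by
    rw [hm, Measure.map_apply hu measurableSet_Ici, ← tiltedUniform_apply hK hK0 ξ (hhalf s)]
    rfl
  have key := exp_neg_one_le_measureReal_Ici m hint hmean fun s t a b ha hb hab => by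
    rw [htail, htail, htail, ENNReal.mul_rpow_of_nonneg _ _ ha.le,
      ENNReal.mul_rpow_of_nonneg _ _ hb.le, mul_mul_mul_comm,
      ← ENNReal.rpow_add _ _ (by simp) (by simpa using hF), hab, ENNReal.rpow_one]
    gcongr
    refine setLIntegral_exp_inner_log_concave ξ ((hhalf s).inter hK.measurableSet)
      ((hhalf t).inter hK.measurableSet) ((hhalf _).inter hK.measurableSet) ha hb hab ?_
    rintro x ⟨hxs, hx⟩ y ⟨hyt, hy⟩
    refine ⟨?_, hKc hx hy ha.le hb.le hab⟩
    rw [Set.mem_ofPred] at hxs hyt ⊢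
    rw [inner_add_right, real_inner_smul_right, real_inner_smul_right]
    gcongr
  rwa [hm, map_measureReal_apply hu measurableSet_Ici] at key

/-- Chernoff's bound with parameter r = 2/√n: the growth estimate contributes n r²/2 = 2 and the
threshold contributes -2√n·r = -4. -/
lemma tiltedUniform_le_exp_neg_two (hn : 1 ≤ n) (hK : IsCompact K) (hKc : Convex ℝ K)
    (hK0 : (interior K).Nonempty) {ξ : EuclideanSpace ℝ (Fin n)}
    (hξ : ∀ η, expIntegral K ξ ≤ expIntegral K η) :
    (tiltedUniform K ξ).real {z | 2 * √(n : ℝ) ≤ inner ℝ ξ z} ≤ Real.exp (-2) := by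
  have := isProbabilityMeasure_tiltedUniform hK hK0 ξ
  have hF := expIntegral_pos hK hK0 ξ
  have hn0 : (0 : ℝ) < n := by exact_mod_cast hn
  have hs : 0 < √(n : ℝ) := Real.sqrt_pos.2 hn0
  have hsq : √(n : ℝ) ^ 2 = n := Real.sq_sqrt hn0.le
  have ht : 0 < 2 / √(n : ℝ) := by positivity
  refine (ProbabilityTheory.measure_ge_le_exp_mul_mgf (t := 2 / √(n : ℝ)) _ ht.le
    (integrable_exp_mul_inner_tiltedUniform hK ξ ξ _)).trans ?_
  have h1 := expIntegral_smul_le hK hKc hK0 hξ ht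
  rw [mgf_tiltedUniform]
  have h2 : expIntegral K (ξ + (2 / √(n : ℝ)) • ξ) / expIntegral K ξ ≤ Real.exp 2 := by
    have hexp : (n : ℝ) * (2 / √(n : ℝ)) ^ 2 / 2 = 2 := by
      rw [div_pow, hsq]
      field_simp
    rw [hexp, add_smul, one_smul] at h1
    rwa [div_le_iff₀ hF, mul_comm]
  calc _ ≤ Real.exp (-(2 / √(n : ℝ)) * (2 * √(n : ℝ))) * Real.exp 2 := by gcongr
    _ = Real.exp (-2) := by
      rw [← Real.exp_add]
      congr 1
      field_simp
      norm_num

lemma one_tenth_le_exp_neg_one_sub_exp_neg_two :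
    (1 / 10 : ℝ) ≤ Real.exp (-1) - Real.exp (-2) := by
  have h : Real.exp (-2) = Real.exp (-1) * Real.exp (-1) := by
    rw [← Real.exp_add]; norm_num
  have h1 := Real.exp_neg_one_gt_d9
  have h2 := Real.exp_neg_one_lt_d9
  rw [h]
  nlinarith

/-- Every half-space through the origin has a large intersection with `K`. -/
lemma mul_expIntegral_le_volume_halfSpace_inter (hn : 1 ≤ n) (hK : IsCompact K)
    (hKc : Convex ℝ K) (hK0 : (interior K).Nonempty) {ξ : EuclideanSpace ℝ (Fin n)}
    (hξ : ∀ η, expIntegral K ξ ≤ expIntegral K η) (u : EuclideanSpace ℝ (Fin n)) :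
    ENNReal.ofReal (1 / 10 * Real.exp (-2 * √(n : ℝ)) * expIntegral K ξ) ≤
      volume ({z | 0 ≤ inner ℝ u z} ∩ K) := by
  have := isProbabilityMeasure_tiltedUniform hK hK0 ξ
  have hF := expIntegral_pos hK hK0 ξ
  set H : Set (EuclideanSpace ℝ (Fin n)) := {z | 0 ≤ inner ℝ u z}
  set B : Set (EuclideanSpace ℝ (Fin n)) := {z | 2 * √(n : ℝ) ≤ inner ℝ ξ z}
  have hH : MeasurableSet H := measurableSet_le measurable_const (by fun_prop)
  have hB : MeasurableSet B := measurableSet_le measurable_const (by fun_prop)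
  -- Off `B` the tilted density is at most e^{2√n}/F(ξ), which converts tilted mass of `H \ B` into
  -- volume.
  have h1 : (1 / 10 : ℝ) ≤ (tiltedUniform K ξ).real (H \ B) := by
    have h2 := exp_neg_one_le_tiltedUniform hK hKc hK0 hξ u
    have h3 := tiltedUniform_le_exp_neg_two hn hK hKc hK0 hξ
    have h4 := le_measureReal_sdiff (μ := tiltedUniform K ξ) (s₁ := H) (s₂ := B)
    linarith [one_tenth_le_exp_neg_one_sub_exp_neg_two]
  have h2 : ENNReal.ofReal (1 / 10) ≤ (ENNReal.ofReal (expIntegral K ξ))⁻¹ *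
      (ENNReal.ofReal (Real.exp (2 * √(n : ℝ))) * volume (H ∩ K)) := by
    calc _ ≤ tiltedUniform K ξ (H \ B) := by
          rw [← ofReal_measureReal]
          exact ENNReal.ofReal_le_ofReal h1
      _ = (ENNReal.ofReal (expIntegral K ξ))⁻¹ *
            ∫⁻ z in (H \ B) ∩ K, ENNReal.ofReal (Real.exp (inner ℝ ξ z)) :=
          tiltedUniform_apply hK hK0 ξ (hH.diff hB)
      _ ≤ (ENNReal.ofReal (expIntegral K ξ))⁻¹ *
            ∫⁻ z in (H \ B) ∩ K, ENNReal.ofReal (Real.exp (2 * √(n : ℝ))) := by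
          gcongr _ * ?_
          refine setLIntegral_mono' ((hH.diff hB).inter hK.measurableSet) fun z hz => ?_
          exact ENNReal.ofReal_le_ofReal (Real.exp_le_exp.2 (not_le.1 hz.1.2).le)
      _ ≤ _ := by
          rw [setLIntegral_const]
          gcongr
          exact Set.sdiff_subset
  have h3 := mul_le_mul_right h2
    (ENNReal.ofReal (Real.exp (-2 * √(n : ℝ))) * ENNReal.ofReal (expIntegral K ξ))
  have h4 : ENNReal.ofReal (Real.exp (-2 * √(n : ℝ))) * ENNReal.ofReal (expIntegral K ξ) *
      ((ENNReal.ofReal (expIntegral K ξ))⁻¹ *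
        (ENNReal.ofReal (Real.exp (2 * √(n : ℝ))) * volume (H ∩ K))) = volume (H ∩ K) := by
    rw [mul_assoc, ← mul_assoc (ENNReal.ofReal (expIntegral K ξ)),
      ENNReal.mul_inv_cancel (by simpa using hF) ENNReal.ofReal_ne_top, one_mul, ← mul_assoc,
      ← ENNReal.ofReal_mul (Real.exp_pos _).le, ← Real.exp_add]
    simp
  rw [h4, ← ENNReal.ofReal_mul (Real.exp_pos _).le,
    ← ENNReal.ofReal_mul (mul_nonneg (Real.exp_pos _).le hF.le)] at h3
  refine le_trans (le_of_eq ?_) h3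
  ring_nf

end

/-! ### Comparison of the depth with the Cramér transform -/

namespace TukeyCramer

section

variable {n : ℕ} {K : Set (EuclideanSpace ℝ (Fin n))}

lemma uniformMeasure_eq_restrict (hvol : volume K = 1) :
    uniformMeasure K = volume.restrict K := by
  rw [uniformMeasure, ProbabilityTheory.cond, hvol, inv_one, one_smul]

lemma logLaplace_uniformMeasure (hK : IsConvexBody K) (hvol : volume K = 1)
    (ξ : EuclideanSpace ℝ (Fin n)) :
    logLaplace (uniformMeasure K) ξ = (Real.log (expIntegral K ξ) : EReal) := by
  rw [logLaplace, uniformMeasure_eq_restrict hvol, ← ofReal_expIntegral hK.isCompact,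
    ENNReal.log_ofReal_of_pos (expIntegral_pos hK.isCompact hK.nonempty_interior ξ)]

lemma cramer_uniformMeasure (hK : IsConvexBody K) (hvol : volume K = 1)
    (x : EuclideanSpace ℝ (Fin n)) :
    cramer (uniformMeasure K) x =
      ⨆ ξ, ((inner ℝ ξ x - Real.log (expIntegral K ξ) : ℝ) : EReal) := by
  refine iSup_congr fun ξ => ?_
  rw [logLaplace_uniformMeasure hK hvol, EReal.coe_sub, real_inner_comm]

lemma log_one_div_ofReal {c : ℝ} (hc : 0 < c) :
    ENNReal.log (1 / ENNReal.ofReal c) = ((-Real.log c : ℝ) : EReal) := by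
  rw [one_div, ENNReal.log_inv, ENNReal.log_ofReal_of_pos hc, EReal.coe_neg]

/-- A functional strictly separates x from the open set `interior K`, which fills K up to a null set
even when x is on the boundary. Along multiples kξ of it, e^{-k⟨ξ,x⟩} F(kξ) tends to 0 by dominated
convergence. -/
lemma cramer_uniformMeasure_eq_top (hK : IsConvexBody K) (hvol : volume K = 1)
    {x : EuclideanSpace ℝ (Fin n)} (hx : x ∉ interior K) :
    cramer (uniformMeasure K) x = ⊤ := by
  obtain ⟨f, hf⟩ := geometric_hahn_banach_open_point hK.convex.interior isOpen_interior hx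
  set ξ := (InnerProductSpace.toDual ℝ (EuclideanSpace ℝ (Fin n))).symm f
  have hξ : ∀ z, inner ℝ ξ z = f z := fun z => InnerProductSpace.toDual_symm_apply
  have hint : (interior K : Set _) =ᵐ[volume] K :=
    interior_ae_eq_of_null_frontier (hK.convex.addHaar_frontier volume)
  have hfin : volume (interior K) ≠ ⊤ :=
    ne_top_of_le_ne_top (hvol ▸ ENNReal.one_ne_top) (measure_mono interior_subset)
  have htend : Filter.Tendsto
      (fun k : ℕ => ∫ z in interior K, Real.exp (k * (inner ℝ ξ z - inner ℝ ξ x)))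
      Filter.atTop (nhds (∫ _ in interior K, (0 : ℝ))) := by
    refine tendsto_integral_of_dominated_convergence (fun _ => 1) (fun k => ?_)
      (integrableOn_const hfin) (fun k => ?_) ?_
    · exact Continuous.aestronglyMeasurable (by fun_prop)
    · refine (ae_restrict_mem isOpen_interior.measurableSet).mono fun z hz => ?_
      rw [Real.norm_of_nonneg (Real.exp_pos _).le, Real.exp_le_one_iff, hξ, hξ]
      exact mul_nonpos_of_nonneg_of_nonpos (Nat.cast_nonneg k) (sub_nonpos.2 (hf z hz).le)
    · refine (ae_restrict_mem isOpen_interior.measurableSet).mono fun z hz => ?_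
      refine Real.tendsto_exp_atBot.comp
        (tendsto_natCast_atTop_atTop.atTop_mul_const_of_neg ?_)
      rw [hξ, hξ]
      exact sub_neg.2 (hf z hz)
  rw [integral_zero] at htend
  rw [cramer_uniformMeasure hK hvol, EReal.eq_top_iff_forall_lt]
  intro M
  obtain ⟨k, hk⟩ := (htend.eventually_lt_const (Real.exp_pos (-M))).exists
  refine lt_of_lt_of_le (EReal.coe_lt_coe_iff.2 ?_) (le_iSup
    (fun ξ => ((inner ℝ ξ x - Real.log (expIntegral K ξ) : ℝ) : EReal)) ((k : ℝ) • ξ))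
  have heq : ∫ z in interior K, Real.exp (k * (inner ℝ ξ z - inner ℝ ξ x)) =
      Real.exp (-(k * inner ℝ ξ x)) * expIntegral K ((k : ℝ) • ξ) := by
    rw [setIntegral_congr_set hint, expIntegral, ← integral_const_mul]
    refine integral_congr_ae (Filter.Eventually.of_forall fun z => ?_)
    simp only [real_inner_smul_left, ← Real.exp_add]
    ring_nf
  have hpos := expIntegral_pos hK.isCompact hK.nonempty_interior ((k : ℝ) • ξ)
  rw [heq] at hk
  have h1 := Real.log_lt_log (by positivity) hk
  rw [Real.log_mul (by positivity) hpos.ne', Real.log_exp, Real.log_exp] at h1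
  rw [real_inner_smul_left]
  linarith

lemma expIntegral_translate (K : Set (EuclideanSpace ℝ (Fin n)))
    (ξ x : EuclideanSpace ℝ (Fin n)) :
    expIntegral ((fun z => z + x) ⁻¹' K) ξ = Real.exp (-inner ℝ ξ x) * expIntegral K ξ := by
  have h := (measurePreserving_add_right volume x).setIntegral_preimage_emb
    (measurableEmbedding_addRight x) (fun y => Real.exp (inner ℝ ξ (y - x))) K
  simp only [add_sub_cancel_right] at h
  rw [expIntegral, h, expIntegral, ← integral_const_mul]
  refine integral_congr_ae (Filter.Eventually.of_forall fun z => ?_)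
  simp only [inner_sub_right, ← Real.exp_add]
  ring_nf

/-- At an interior point the depth is bounded below in terms of a value entering the supremum
that defines the Cramér transform. -/
lemma exists_le_cramer_and_le_depth (hn : 1 ≤ n) (hK : IsConvexBody K) (hvol : volume K = 1)
    {x : EuclideanSpace ℝ (Fin n)} (hx : x ∈ interior K) :
    ∃ r : ℝ, (r : EReal) ≤ cramer (uniformMeasure K) x ∧
      ENNReal.ofReal (1 / 10 * Real.exp (-2 * √(n : ℝ)) * Real.exp (-r)) ≤
        depth (uniformMeasure K) x := by
  set K' := (fun z => z + x) ⁻¹' K with hK'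
  have hcomp : IsCompact K' := (Homeomorph.addRight x).isCompact_preimage.2 hK.isCompact
  have hconv : Convex ℝ K' := hK.convex.translate_preimage_left x
  have h0 : (0 : EuclideanSpace ℝ (Fin n)) ∈ interior K' := by
    have : interior K' = (fun z => z + x) ⁻¹' interior K :=
      ((Homeomorph.addRight x).preimage_interior K).symm
    rw [this]
    simpa using hx
  obtain ⟨ξ, hξ⟩ := exists_expIntegral_le hcomp h0
  have hpos := expIntegral_pos hK.isCompact hK.nonempty_interior ξ
  refine ⟨inner ℝ ξ x - Real.log (expIntegral K ξ), ?_, ?_⟩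
  · rw [cramer_uniformMeasure hK hvol]
    exact le_iSup (fun ξ => ((inner ℝ ξ x - Real.log (expIntegral K ξ) : ℝ) : EReal)) ξ
  · have hexp : Real.exp (-(inner ℝ ξ x - Real.log (expIntegral K ξ))) = expIntegral K' ξ := by
      rw [hK', expIntegral_translate, neg_sub, sub_eq_add_neg, Real.exp_add, Real.exp_log hpos,
        mul_comm]
    rw [hexp]
    refine le_iInf₂ fun H hH => ?_
    obtain ⟨⟨θ, a, -, rfl⟩, hxH⟩ := hH
    refine (mul_expIntegral_le_volume_halfSpace_inter hn hcomp hconv ⟨0, h0⟩ hξ θ).trans ?_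
    have hHm : MeasurableSet {z : EuclideanSpace ℝ (Fin n) | a ≤ inner ℝ θ z} :=
      measurableSet_le measurable_const (by fun_prop)
    rw [uniformMeasure_eq_restrict hvol, Measure.restrict_apply hHm,
      ← measure_preimage_add_right volume x ({z | a ≤ inner ℝ θ z} ∩ K)]
    refine measure_mono fun z hz => ⟨?_, hz.2⟩
    have h1 : (0 : ℝ) ≤ inner ℝ θ z := hz.1
    have h2 : a ≤ inner ℝ θ x := hxH
    change a ≤ inner ℝ θ (z + x)
    rw [inner_add_right]
    linarith

lemma depth_le_exp (hn : 1 ≤ n) (hK : IsConvexBody K) (hvol : volume K = 1)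
    (x ξ : EuclideanSpace ℝ (Fin n)) :
    depth (uniformMeasure K) x ≤
      ENNReal.ofReal (Real.exp (-(inner ℝ ξ x - Real.log (expIntegral K ξ)))) := by
  have hmem : ∀ θ : EuclideanSpace ℝ (Fin n), θ ≠ 0 →
      {z | inner ℝ θ x ≤ inner ℝ θ z} ∈ halfSpacesAt x := fun θ hθ =>
    ⟨⟨θ, inner ℝ θ x, hθ, rfl⟩, le_refl (inner ℝ θ x : ℝ)⟩
  have hprob : IsProbabilityMeasure (volume.restrict K) := ⟨by simpa using hvol⟩
  rw [uniformMeasure_eq_restrict hvol]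
  -- ξ = 0 defines no half-space; there the bound equals |K| = 1 and any half-space at x serves, a
  -- nonzero normal existing because n ≥ 1.
  by_cases hξ : ξ = 0
  · have hθ : (EuclideanSpace.single (⟨0, hn⟩ : Fin n) (1 : ℝ)) ≠ 0 := by simp
    refine (iInf₂_le _ (hmem _ hθ)).trans (prob_le_one.trans ?_)
    simp [hξ, expIntegral, measureReal_def]
  · refine (iInf₂_le _ (hmem ξ hξ)).trans ?_
    have hpos := expIntegral_pos hK.isCompact hK.nonempty_interior ξ
    have := ProbabilityTheory.measure_ge_le_exp_mul_mgf (μ := volume.restrict K)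
      (X := fun z => inner ℝ ξ z) (t := 1) (inner ℝ ξ x) zero_le_one
      (by simpa [IntegrableOn] using integrableOn_exp_inner hK.isCompact ξ)
    have hmgf : ProbabilityTheory.mgf (fun z => inner ℝ ξ z) (volume.restrict K) 1 =
        expIntegral K ξ := by
      simp [ProbabilityTheory.mgf, expIntegral]
    rw [hmgf] at this
    rw [← ofReal_measureReal]
    refine ENNReal.ofReal_le_ofReal (this.trans (le_of_eq ?_))
    rw [neg_sub, sub_eq_add_neg, Real.exp_add, Real.exp_log hpos, mul_comm]
    simp

lemma cramer_le_omega (hn : 1 ≤ n) (hK : IsConvexBody K) (hvol : volume K = 1)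
    (x : EuclideanSpace ℝ (Fin n)) :
    cramer (uniformMeasure K) x ≤ omega (uniformMeasure K) x := by
  rw [cramer_uniformMeasure hK hvol]
  refine iSup_le fun ξ => ?_
  set r : ℝ := inner ℝ ξ x - Real.log (expIntegral K ξ)
  have h := log_one_div_ofReal (Real.exp_pos (-r))
  rw [Real.log_exp, neg_neg] at h
  rw [← h, omega]
  exact ENNReal.log_monotone (ENNReal.div_le_div_left (depth_le_exp hn hK hvol x ξ) 1)

lemma exists_omega_le (hn : 1 ≤ n) (hK : IsConvexBody K) (hvol : volume K = 1)
    {x : EuclideanSpace ℝ (Fin n)} (hx : x ∈ interior K) :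
    ∃ r : ℝ, (r : EReal) ≤ cramer (uniformMeasure K) x ∧
      omega (uniformMeasure K) x ≤ ((r + 5 * √(n : ℝ) : ℝ) : EReal) := by
  obtain ⟨r, hr, hd⟩ := exists_le_cramer_and_le_depth hn hK hvol hx
  refine ⟨r, hr, ?_⟩
  refine (ENNReal.log_monotone (ENNReal.div_le_div_left hd 1)).trans ?_
  rw [log_one_div_ofReal (by positivity), EReal.coe_le_coe_iff,
    Real.log_mul (by positivity) (by positivity), Real.log_mul (by positivity) (by positivity),
    Real.log_exp, Real.log_exp, one_div, Real.log_inv]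
  have h1 : 1 ≤ √(n : ℝ) := Real.one_le_sqrt.2 (by exact_mod_cast hn)
  -- The loss 2√n + log 10 is absorbed by 5√n, since log 10 ≤ 3 ≤ 3√n.
  have h2 : Real.log 10 ≤ 3 := by
    rw [Real.log_le_iff_le_exp (by norm_num)]
    have h3 : Real.exp 3 = Real.exp 1 ^ 3 := by rw [← Real.exp_nat_mul]; norm_num
    rw [h3]
    have h4 : (2.7 : ℝ) ≤ Real.exp 1 := by linarith [Real.exp_one_gt_d9]
    calc (10 : ℝ) ≤ 2.7 ^ 3 := by norm_num
      _ ≤ _ := by gcongr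
  linarith

end

end TukeyCramer

theorem theorem1p1 (n : ℕ) (hn : 1 ≤ n) (K : Set (EuclideanSpace ℝ (Fin n)))
    (hK : TukeyCramer.IsConvexBody K) (hvol : volume K = 1) (hcent : TukeyCramer.IsCentered K) :
    (∀ t : ℝ, 0 < t →
      ENNReal.ofReal (1 / 10 * Real.exp (-t - 2 * √(n : ℝ))) ≤
        ⨅ x ∈ TukeyCramer.cramerSublevel (TukeyCramer.uniformMeasure K) t,
          TukeyCramer.depth (TukeyCramer.uniformMeasure K) x) ∧
    (∀ x : EuclideanSpace ℝ (Fin n),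
      TukeyCramer.omega (TukeyCramer.uniformMeasure K) x - ((5 * √(n : ℝ) : ℝ) : EReal) ≤
          TukeyCramer.cramer (TukeyCramer.uniformMeasure K) x ∧
        TukeyCramer.cramer (TukeyCramer.uniformMeasure K) x ≤
          TukeyCramer.omega (TukeyCramer.uniformMeasure K) x) ∧
    (∀ x ∈ interior K, TukeyCramer.omega (TukeyCramer.uniformMeasure K) x < ⊤) := by
  refine ⟨fun t _ => le_iInf₂ fun x hx => ?_, fun x => ⟨?_, ?_⟩, fun x hx => ?_⟩
  · have hxt : TukeyCramer.cramer (TukeyCramer.uniformMeasure K) x ≤ (t : EReal) := hx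
    -- A finite value of the Cramér transform forces x into the interior.
    have hxK : x ∈ interior K := by
      by_contra h
      rw [TukeyCramer.cramer_uniformMeasure_eq_top hK hvol h] at hxt
      exact (EReal.coe_lt_top t).not_ge hxt
    obtain ⟨r, hr, hd⟩ := TukeyCramer.exists_le_cramer_and_le_depth hn hK hvol hxK
    have hrt : r ≤ t := EReal.coe_le_coe_iff.1 (hr.trans hxt)
    refine le_trans (ENNReal.ofReal_le_ofReal ?_) hd
    rw [mul_assoc, ← Real.exp_add]
    gcongr
    linarith
  · by_cases hxK : x ∈ interior K
    · obtain ⟨r, hr, ho⟩ := TukeyCramer.exists_omega_le hn hK hvol hxK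
      refine le_trans ?_ hr
      rw [EReal.sub_le_iff_le_add (by simp) (by simp), ← EReal.coe_add]
      exact ho
    · rw [TukeyCramer.cramer_uniformMeasure_eq_top hK hvol hxK]
      exact le_top
  · exact TukeyCramer.cramer_le_omega hn hK hvol x
  · obtain ⟨r, -, ho⟩ := TukeyCramer.exists_omega_le hn hK hvol hx
    exact ho.trans_lt (EReal.coe_lt_top _)
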